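/- Let $n$ be a natural number, let $M_n$ be the algebra of all $n\times n$ complex matrices, $M_n^{-1}$ the group of invertible matrices in $M_n$, and $E$ the identity matrix. For $M\in M_n$ let $M^t$ be the transpose and $\overline{M}$ the entrywise complex conjugate of $M$. Let $\|\cdot\|$ and $\|\cdot\|'$ be any two matrix norms on $M_n$, i.e. submultiplicative norms on the complex vector space $M_n$ (not necessarily taking the value $1$ at $E$). Let $\mathfrak{A}$ and $\mathfrak{B}$ be open subgroups of $M_n^{-1}$, and let $S$ be a surjection from $\mathfrak{A}$ onto $\mathfrak{B}$ such that $\|S(M)-S(N)\|'=\|M-N\|$ for all $M,N\in\mathfrak{A}$. Then there exists an invertible matrix $U\in M_n$ such that one of the following holds: 1. $S(M)=S(E)\,U M U^{-1}$ for all $M\in\mathfrak{A}$; 2. $S(M)=S(E)\,U M^t U^{-1}$ for all $M\in\mathfrak{A}$; 3. $S(M)=S(E)\,U \overline{M} U^{-1}$ for all $M\in\mathfrak{A}$; 4. $S(M)=S(E)\,U \overline{M}^{\,t} U^{-1}$ for all $M\in\mathfrak{A}$. In particular, if $S$ is unital, i.e. $S(E)=E$, then $S$ is multiplicative ($S(MN)=S(M)S(N)$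 for all $M,N\in\mathfrak{A}$) or anti-multiplicative ($S(MN)=S(N)S(M)$ for all $M,N\in\mathfrak{A}$). -/

import Mathlib

open scoped Matrix MatrixGroups

/-!
Invertible matrices are dense, so the isometry extends to the whole matrix space and the extension
is real-affine by the Mazur–Ulam theorem. An open subgroup of the connected group `GL n ℂ` is
everything, so the extension preserves invertibility in both directions. This kills the translation
part. It also forces matrices of rank at most one to be preserved: they are characterized by the
absence of an invertible `C` with both `C + A` and `C - A` singular, which the identity
`det (C + A) + det (C - A) = 2 * det C` provides in one direction.

After multiplication by an invertible matrix and a conjugation, such a map fixes the diagonal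
matrix units, so it maps each row space to a row space or each one to a column space. In the first
case (the second is its transpose) it acts entrywise, and its values on rank-one matrices make it
`A ↦ D * A.map σ * D⁻¹` with `D` diagonal and `σ` a field endomorphism; as `σ` is real-linear, it
is the identity or the complex conjugation. In size at most one invertibility preservation carries
no information, and one uses instead that every seminorm is a multiple of the absolute value.
-/

section MazurUlam

theorem exists_isometryEquiv_of_denseRange {ι E F : Type*} [MetricSpace E] [CompleteSpace E]
    [MetricSpace F] [CompleteSpace F] {a : ι → E} {b : ι → F} (ha : DenseRange a)
    (hb : DenseRange b) (hab : ∀ i j, dist (b i) (b j) = dist (a i) (a j)) :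
    ∃ e : E ≃ᵢ F, ∀ i, e (a i) = b i := by
  let _ : PseudoMetricSpace ι := .induced a inferInstance
  have ia : Isometry a := .of_dist_eq fun _ _ => rfl
  have ib : Isometry b := .of_dist_eq hab
  let completionE : AbstractCompletion ι := ⟨E, a, _, ‹_›, inferInstance, ia.isUniformInducing, ha⟩
  let completionF : AbstractCompletion ι := ⟨F, b, _, ‹_›, inferInstance, ib.isUniformInducing, hb⟩
  let e : E ≃ᵤ F := completionE.compareEquiv completionF
  have he : ∀ i, e (a i) = b i := completionE.compare_coe completionF
  refine ⟨⟨e.toEquiv, .of_dist_eq fun x y => ?_⟩, he⟩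
  refine ha.induction_on₂ (p := fun x y => dist (e x) (e y) = dist x y) ?_ (fun i j => ?_) x y
  · have := e.continuous
    exact isClosed_eq (by fun_prop) (by fun_prop)
  · rw [he, he, hab]

theorem exists_linearIsometryEquiv_add_of_denseRange {ι E F : Type*}
    [NormedAddCommGroup E] [NormedSpace ℝ E] [CompleteSpace E]
    [NormedAddCommGroup F] [NormedSpace ℝ F] [CompleteSpace F] {a : ι → E} {b : ι → F}
    (ha : DenseRange a) (hb : DenseRange b) (hab : ∀ i j, ‖b i - b j‖ = ‖a i - a j‖) :
    ∃ (T : E ≃ₗᵢ[ℝ] F) (c : F), ∀ i, T (a i) + c = b i := by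
  obtain ⟨e, he⟩ := exists_isometryEquiv_of_denseRange ha hb (by simpa only [dist_eq_norm])
  refine ⟨e.toRealLinearIsometryEquiv, e 0, fun i => ?_⟩
  rw [e.toRealLinearIsometryEquiv_apply, sub_add_cancel, he]

theorem exists_linearEquiv_add_of_seminorm {ι V W : Type*}
    [AddCommGroup V] [Module ℝ V] [FiniteDimensional ℝ V]
    [AddCommGroup W] [Module ℝ W] [FiniteDimensional ℝ W] {p : Seminorm ℝ V} {q : Seminorm ℝ W}
    (hp : ∀ x, p x = 0 → x = 0) (hq : ∀ x, q x = 0 → x = 0) {a : ι → V} {b : ι → W}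
    (ha : ∀ x, ∀ ε > 0, ∃ i, p (x - a i) < ε) (hb : ∀ x, ∀ ε > 0, ∃ i, q (x - b i) < ε)
    (hab : ∀ i j, q (b i - b j) = p (a i - a j)) :
    ∃ (T : V ≃ₗ[ℝ] W) (c : W), (∀ x, q (T x) = p x) ∧ ∀ i, T (a i) + c = b i := by
  let _ : NormedAddCommGroup V := AddGroupNorm.toNormedAddCommGroup
    { p.toAddGroupSeminorm with eq_zero_of_map_eq_zero' := hp }
  let _ : NormedAddCommGroup W := AddGroupNorm.toNormedAddCommGroup
    { q.toAddGroupSeminorm with eq_zero_of_map_eq_zero' := hq }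
  let _ : NormedSpace ℝ V := ⟨fun r x => (map_smul_eq_mul p r x).le⟩
  let _ : NormedSpace ℝ W := ⟨fun r x => (map_smul_eq_mul q r x).le⟩
  have := FiniteDimensional.complete ℝ V
  have := FiniteDimensional.complete ℝ W
  obtain ⟨T, c, hT⟩ := exists_linearIsometryEquiv_add_of_denseRange (a := a) (b := b)
    (Metric.denseRange_iff.2 fun x ε hε => (ha x ε hε).imp fun i hi => by rwa [dist_eq_norm])
    (Metric.denseRange_iff.2 fun x ε hε => (hb x ε hε).imp fun i hi => by rwa [dist_eq_norm]) hab
  exact ⟨T.toLinearEquiv, c, T.norm_map, hT⟩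

end MazurUlam

section GeneralLinearGroup

open Matrix

variable {n : Type*} [Fintype n] [DecidableEq n]

theorem finite_setOf_not_isUnit_lineMap_one {K : Type*} [Field K] (A : Matrix n n K) :
    {z : K | ¬IsUnit (AffineMap.lineMap 1 A z)}.Finite := by
  have eval_charpolyRev_eq (z : K) :
      (1 - A).charpolyRev.eval z = (AffineMap.lineMap 1 A z : Matrix n n K).det := by
    rw [charpolyRev, ← Polynomial.coe_evalRingHom, RingHom.map_det, AffineMap.lineMap_apply_module']
    congr 1
    rw [map_sub, map_one, ← neg_sub 1 A, smul_neg, neg_add_eq_sub]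
    congr 1
    ext i j
    simp
  classical
  have hp : (1 - A).charpolyRev ≠ 0 := fun h => by simpa [h] using (1 - A).eval_charpolyRev
  refine (1 - A).charpolyRev.roots.toFinset.finite_toSet.subset fun z hz => ?_
  simpa [hp, eval_charpolyRev_eq, isUnit_iff_isUnit_det] using hz

theorem exists_GL_seminorm_sub_lt (p : Seminorm ℂ (Matrix n n ℂ)) (A : Matrix n n ℂ) {ε : ℝ}
    (hε : 0 < ε) : ∃ g : GL n ℂ, p (A - g.val) < ε := by
  have hpos : 0 < p (A - 1) + 1 := by positivity
  obtain ⟨z, hz, hz1⟩ := ((finite_setOf_not_isUnit_lineMap_one A).countable.dense_compl ℂ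
    ).exists_dist_lt 1 (div_pos hε hpos)
  obtain ⟨g, hg⟩ := not_not.1 hz
  have hsub : A - g.val = (1 - z) • (A - 1) := by
    rw [hg, AffineMap.lineMap_apply_module']
    module
  refine ⟨g, ?_⟩
  calc p (A - g.val) = dist 1 z * p (A - 1) := by rw [hsub, map_smul_eq_mul, dist_eq_norm]
    _ ≤ dist 1 z * (p (A - 1) + 1) := by gcongr; linarith
    _ < ε := (lt_div_iff₀ hpos).1 hz1

theorem isPreconnected_setOf_isUnit : IsPreconnected {A : Matrix n n ℂ | IsUnit A} := by
  refine isPreconnected_of_forall 1 fun A hA => ?_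
  let line : ℂ → Matrix n n ℂ := AffineMap.lineMap 1 A
  have hline : Continuous line := by fun_prop
  have hZ : IsPreconnected {z | ¬IsUnit (line z)}ᶜ :=
    (finite_setOf_not_isUnit_lineMap_one A).countable.isConnected_compl_of_one_lt_rank
      (by simp [Complex.rank_real_complex]) |>.isPreconnected
  refine ⟨line '' {z | ¬IsUnit (line z)}ᶜ, ?_, ⟨0, ?_⟩, ⟨1, ?_⟩, hZ.image _ hline.continuousOn⟩
  · rintro _ ⟨z, hz, rfl⟩
    exact not_not.1 hz
  · simp [line]
  · simpa [line] using hA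

theorem preconnectedSpace_GL : PreconnectedSpace (GL n ℂ) := by
  have continuousOn_inv : ContinuousOn Inv.inv {A : Matrix n n ℂ | IsUnit A} := by
    intro A hA
    refine (continuousAt_matrix_inv A ?_).continuousWithinAt
    rw [Ring.inverse_eq_inv']
    exact continuousAt_inv₀ ((isUnit_iff_isUnit_det A).1 hA).ne_zero
  have val_inducing : Topology.IsInducing (Units.val : GL n ℂ → Matrix n n ℂ) :=
    (Units.isEmbedding_val_mk' continuousOn_inv fun u => (coe_units_inv u).symm).isInducing
  refine ⟨val_inducing.isPreconnected_image.1 ?_⟩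
  rw [Set.image_univ]
  exact isPreconnected_setOf_isUnit

theorem mem_openSubgroup_GL (H : OpenSubgroup (GL n ℂ)) (g : GL n ℂ) : g ∈ H := by
  have := preconnectedSpace_GL (n := n)
  have hH : (H : Set (GL n ℂ)) = Set.univ := H.isClopen.eq_univ ⟨1, one_mem H⟩
  exact SetLike.mem_coe.1 (hH ▸ Set.mem_univ g)

end GeneralLinearGroup

section RankOne

open Matrix

theorem rank_le_one_iff_exists_vecMulVec {m n K : Type*} [Fintype n] [Field K]
    {A : Matrix m n K} : A.rank ≤ 1 ↔ ∃ x y, A = vecMulVec x y := by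
  classical
  refine ⟨fun hA => ?_, ?_⟩
  · obtain ⟨x, hx⟩ := finrank_le_one_iff.1 hA
    choose y hy using fun j => hx ⟨A *ᵥ Pi.single j 1, LinearMap.mem_range_self A.mulVecLin _⟩
    refine ⟨x, y, ext fun i j => ?_⟩
    have hij := congrFun (congrArg Subtype.val (hy j)) i
    simp only [mulVec_single_one, Submodule.coe_smul, Pi.smul_apply, smul_eq_mul, col_apply] at hij
    rw [← hij, vecMulVec_apply, mul_comm]
  · rintro ⟨x, y, rfl⟩
    exact rank_vecMulVec_le x y

theorem mul_apply_comm_of_rank_le_one {m n K : Type*} [Fintype n] [Field K]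
    {A : Matrix m n K} (hA : A.rank ≤ 1) (i k : m) (j l : n) :
    A i j * A k l = A i l * A k j := by
  obtain ⟨x, y, rfl⟩ := rank_le_one_iff_exists_vecMulVec.1 hA
  simp only [vecMulVec_apply]
  ring

variable {n K : Type*} [Fintype n] [DecidableEq n] [Field K]

theorem exists_isUnit_mulVec_eq {ι : Type*} [Finite ι] {v w : ι → n → K}
    (hv : LinearIndependent K v) (hw : LinearIndependent K w) :
    ∃ C : Matrix n n K, IsUnit C ∧ ∀ i, C *ᵥ v i = w i := by
  have := FiniteDimensional.span_of_finite K (Set.finite_range v)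
  obtain ⟨g, hg⟩ := Submodule.exists_linearEquiv_restrict_eq
    (hv.linearCombinationEquiv.symm ≪≫ₗ hw.linearCombinationEquiv)
  refine ⟨LinearMap.toMatrix' g.toLinearMap, ?_, fun i => ?_⟩
  · rw [isUnit_iff_isUnit_det, LinearMap.det_toMatrix']
    exact g.isUnit_det'
  · have hvi : (hv.linearCombinationEquiv (Finsupp.single i 1) : n → K) = v i := by simp
    rw [LinearMap.toMatrix'_mulVec, LinearEquiv.coe_coe, ← hvi, ← hg]
    simp

theorem not_isUnit_of_mulVec_eq_zero {A : Matrix n n K} {v : n → K} (hv : v ≠ 0)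
    (hAv : A *ᵥ v = 0) : ¬IsUnit A := fun hA =>
  hv (mulVec_injective_of_isUnit hA (by rw [hAv, mulVec_zero]))

theorem det_add_vecMulVec {R : Type*} [CommRing R] {C : Matrix n n R} (hC : IsUnit C)
    (x y : n → R) :
    (C + vecMulVec x y).det = C.det * (1 + y ⬝ᵥ C⁻¹ *ᵥ x) := by
  rw [vecMulVec_eq Unit,
    det_add_replicateCol_mul_replicateRow ((isUnit_iff_isUnit_det C).1 hC),
    det_unique (n := Unit), Matrix.add_apply, one_apply_eq, Matrix.mul_assoc, ← replicateCol_mulVec,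
    replicateRow_mul_replicateCol_apply]

theorem det_add_add_det_sub_of_rank_le_one {C A : Matrix n n K} (hC : IsUnit C) (hA : A.rank ≤ 1) :
    (C + A).det + (C - A).det = 2 * C.det := by
  obtain ⟨x, y, rfl⟩ := rank_le_one_iff_exists_vecMulVec.1 hA
  rw [sub_eq_add_neg, ← neg_vecMulVec, det_add_vecMulVec hC, det_add_vecMulVec hC, mulVec_neg,
    dotProduct_neg]
  ring

theorem isUnit_add_or_isUnit_sub_of_rank_le_one [NeZero (2 : K)] {C A : Matrix n n K}
    (hC : IsUnit C) (hA : A.rank ≤ 1) : IsUnit (C + A) ∨ IsUnit (C - A) := by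
  by_contra! h
  have hdet := det_add_add_det_sub_of_rank_le_one hC hA
  simp only [isUnit_iff_isUnit_det, isUnit_iff_ne_zero, not_not] at h hC
  rw [h.1, h.2, add_zero, zero_eq_mul] at hdet
  exact hdet.elim two_ne_zero hC

theorem exists_isUnit_not_isUnit_add_not_isUnit_sub {B : Matrix n n K} (hB : 1 < B.rank) :
    ∃ C, IsUnit C ∧ ¬IsUnit (C + B) ∧ ¬IsUnit (C - B) := by
  obtain ⟨v, w, hind⟩ : ∃ v w, LinearIndependent K ![B *ᵥ v, B *ᵥ w] := by
    have : Nontrivial (LinearMap.range B.mulVecLin) :=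
      Module.nontrivial_of_finrank_pos (R := K) (zero_lt_one.trans hB)
    obtain ⟨⟨_, v, rfl⟩, hv⟩ := exists_ne (0 : LinearMap.range B.mulVecLin)
    obtain ⟨⟨_, w, rfl⟩, hvw⟩ := exists_linearIndependent_pair_of_one_lt_finrank hB hv
    refine ⟨v, w, ?_⟩
    simpa [LinearIndependent.pair_iff, Subtype.ext_iff] using hvw
  have hvw : LinearIndependent K ![v, w] := by
    refine .of_comp B.mulVecLin ?_
    convert hind
    ext i : 1
    fin_cases i <;> rfl
  have hind' : LinearIndependent K ![-(B *ᵥ v), B *ᵥ w] := by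
    simpa using hind.units_smul ![-1, 1]
  obtain ⟨C, hC, hCvw⟩ := exists_isUnit_mulVec_eq hvw hind'
  have hCv : C *ᵥ v = -(B *ᵥ v) := hCvw 0
  have hCw : C *ᵥ w = B *ᵥ w := hCvw 1
  refine ⟨C, hC, not_isUnit_of_mulVec_eq_zero (hvw.ne_zero 0) ?_,
    not_isUnit_of_mulVec_eq_zero (hvw.ne_zero 1) ?_⟩
  · simp [add_mulVec, hCv]
  · simp [sub_mulVec, hCw]

theorem exists_GL_eq_conj_single {P : n → Matrix n n K} (hrank : ∀ i, (P i).rank ≤ 1)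
    (hsum : ∑ i, P i = 1) : ∃ V : GL n K, ∀ i, P i = V.val * single i i 1 * V⁻¹.val := by
  choose x y hxy using fun i => rank_le_one_iff_exists_vecMulVec.1 (hrank i)
  have hmul : (of x)ᵀ * of y = 1 := by
    rw [← hsum]
    ext k l
    simp [mul_apply, Matrix.sum_apply, hxy, vecMulVec_apply]
  refine ⟨⟨(of x)ᵀ, of y, hmul, mul_eq_one_comm.1 hmul⟩, fun i => ?_⟩
  rw [Units.inv_mk, hxy, single_eq_single_vecMulVec_single, mul_vecMulVec, vecMulVec_mul]
  simp

end RankOne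

section InvertibilityPreservers

open Matrix

variable {n K : Type*} [Fintype n] [DecidableEq n] [Field K] [NeZero (2 : K)]
  {T : Matrix n n K ≃+ Matrix n n K}

theorem rank_map_le_one_of_isUnit_map_iff (hT : ∀ A, IsUnit (T A) ↔ IsUnit A) {A : Matrix n n K}
    (hA : A.rank ≤ 1) : (T A).rank ≤ 1 := by
  by_contra! h
  obtain ⟨C, hC, hadd, hsub⟩ := exists_isUnit_not_isUnit_add_not_isUnit_sub h
  obtain ⟨D, rfl⟩ := T.surjective C
  rw [hT] at hC
  rw [← map_add, hT] at hadd
  rw [← map_sub, hT] at hsub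
  exact (isUnit_add_or_isUnit_sub_of_rank_le_one hC hA).elim hadd hsub

theorem eq_zero_of_isUnit_map_add_iff {c : Matrix n n K} (hT : ∀ A, IsUnit (T A + c) ↔ IsUnit A) :
    c = 0 := by
  by_contra hc
  obtain ⟨v, hv⟩ : ∃ v, c *ᵥ v ≠ 0 := by
    by_contra! h
    exact hc (ext_of_mulVec_single fun i => by rw [h, zero_mulVec])
  have hcv : (2 : K) • c *ᵥ v ≠ 0 := smul_ne_zero two_ne_zero hv
  have hv0 : v ≠ 0 := fun h => hv (by rw [h, mulVec_zero])
  obtain ⟨C, hC, hCv⟩ := exists_isUnit_mulVec_eq (ι := Unit) (v := fun _ => v)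
    (w := fun _ => (2 : K) • c *ᵥ v) (.of_subsingleton () hv0) (.of_subsingleton () hcv)
  obtain ⟨A, hA⟩ := T.surjective (c - C)
  have hnot : ¬IsUnit A := by
    rw [← hT, hA]
    refine not_isUnit_of_mulVec_eq_zero hv0 ?_
    rw [add_mulVec, sub_mulVec, hCv (), two_smul]
    abel
  refine hnot (IsUnit.neg_iff A |>.1 ((hT _).1 ?_))
  rwa [map_neg, hA, neg_sub, sub_add_cancel]

end InvertibilityPreservers

section RowsAndColumns

open Matrix

variable {F m n K : Type*} [CommRing F] [Field K] [Algebra F K]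

variable (F n) (K) in
/-- The matrices whose nonzero entries all lie in row `i`, a space of matrices of rank at most
one. The scalars `F` may be smaller than `K`, for maps that are not `K`-linear. -/
def rowSubmodule (i : m) : Submodule F (Matrix m n K) where
  carrier := {A | ∀ k ≠ i, ∀ l, A k l = 0}
  add_mem' hA hB k hk l := by simp [hA k hk l, hB k hk l]
  zero_mem' _ _ _ := rfl
  smul_mem' c A hA k hk l := by simp [hA k hk l]

variable (F m) (K) in
/-- The matrices whose nonzero entries all lie in column `j`, a space of matrices of rank at most
one. The scalars `F` may be smaller than `K`, for maps that are not `K`-linear. -/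
def colSubmodule (j : n) : Submodule F (Matrix m n K) where
  carrier := {A | ∀ l ≠ j, ∀ k, A k l = 0}
  add_mem' hA hB l hl k := by simp [hA l hl k, hB l hl k]
  zero_mem' _ _ _ := rfl
  smul_mem' c A hA l hl k := by simp [hA l hl k]

theorem disjoint_rowSubmodule {i k : m} (hik : i ≠ k) :
    Disjoint (rowSubmodule F n K i) (rowSubmodule F n K k) := by
  refine Submodule.disjoint_def.2 fun A hi hk => ext fun a b => ?_
  obtain rfl | ha := eq_or_ne a i
  · exact hk a hik b
  · exact hi a ha b

theorem disjoint_colSubmodule {j l : n} (hjl : j ≠ l) :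
    Disjoint (colSubmodule F m K j) (colSubmodule F m K l) := by
  refine Submodule.disjoint_def.2 fun A hj hl => ext fun a b => ?_
  obtain rfl | hb := eq_or_ne b j
  · exact hl b hjl a
  · exact hj b hb a

theorem rank_le_one_of_mem_rowSubmodule [Fintype n] {i : m} {A : Matrix m n K}
    (hA : A ∈ rowSubmodule F n K i) : A.rank ≤ 1 := by
  classical
  refine rank_le_one_iff_exists_vecMulVec.2 ⟨Pi.single i 1, A i, ext fun k l => ?_⟩
  obtain rfl | hk := eq_or_ne k i
  · simp [vecMulVec_apply]
  · simp [vecMulVec_apply, hk, hA k hk l]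

theorem rank_le_one_of_mem_colSubmodule [Fintype n] {j : n} {A : Matrix m n K}
    (hA : A ∈ colSubmodule F m K j) : A.rank ≤ 1 := by
  classical
  refine rank_le_one_iff_exists_vecMulVec.2 ⟨A.col j, Pi.single j 1, ext fun k l => ?_⟩
  obtain rfl | hl := eq_or_ne l j
  · simp [vecMulVec_apply]
  · simp [vecMulVec_apply, hl, hA l hl k]

variable [DecidableEq m] [DecidableEq n]

theorem single_mem_rowSubmodule (i : m) (j : n) (z : K) : single i j z ∈ rowSubmodule F n K i :=
  fun _ hk _ => single_apply_of_row_ne hk.symm _ _ _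

theorem single_mem_colSubmodule (i : m) (j : n) (z : K) : single i j z ∈ colSubmodule F m K j :=
  fun _ hl _ => single_apply_of_col_ne _ _ hl.symm _

theorem eq_single_of_mem_rowSubmodule_of_mem_colSubmodule {A : Matrix m n K} {i : m} {j : n}
    (hrow : A ∈ rowSubmodule F n K i) (hcol : A ∈ colSubmodule F m K j) :
    A = single i j (A i j) := by
  ext k l
  obtain rfl | hk := eq_or_ne k i
  · obtain rfl | hl := eq_or_ne l j
    · simp
    · rw [single_apply_of_col_ne _ _ hl.symm, hcol l hl k]
  · rw [single_apply_of_row_ne hk.symm, hrow k hk l]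

theorem le_rowSubmodule_or_le_colSubmodule [Fintype n] {V : Submodule F (Matrix m n K)}
    {i : m} {j : n} (hV : ∀ A ∈ V, A.rank ≤ 1) (hij : single i j 1 ∈ V) :
    V ≤ rowSubmodule F n K i ∨ V ≤ colSubmodule F m K j := by
  refine AddSubgroupClass.subset_union.1 fun A hA => ?_
  have minor_eq := mul_apply_comm_of_rank_le_one (hV A hA) i
  have apply_eq_zero {k : m} {l : n} (hk : k ≠ i) (hl : l ≠ j) : A k l = 0 := by
    have := mul_apply_comm_of_rank_le_one (hV _ (add_mem hA hij)) i k j l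
    simpa [hk.symm, hl.symm, add_mul, minor_eq] using this
  refine or_iff_not_imp_left.2 fun hrow l hl k => ?_
  obtain ⟨k', hk', l', hkl'⟩ : ∃ k' ≠ i, ∃ l', A k' l' ≠ 0 := by
    by_contra! h
    exact hrow h
  obtain rfl : l' = j := by_contra fun hl' => hkl' (apply_eq_zero hk' hl')
  obtain rfl | hk := eq_or_ne k i
  · simpa [apply_eq_zero hk' hl, hkl'] using (minor_eq k' l' l).symm
  · exact apply_eq_zero hk hl

end RowsAndColumns

section NormalizedRankOnePreservers

open Matrix

theorem exists_algHom_of_map_mul_map_comm {F n K : Type*} [CommRing F] [Field K] [Algebra F K]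
    [Nontrivial n] {φ : n → n → K →ₗ[F] K} (hone : ∀ i, φ i i 1 = 1)
    (hφ : ∀ (x y : n → K) (i j k l : n), φ i j (x i * y j) * φ k l (x k * y l) =
      φ i l (x i * y l) * φ k j (x k * y j)) :
    ∃ (σ : K →ₐ[F] K) (d : n → Kˣ), ∀ i j z, φ i j z = d i * σ z * (d j)⁻¹.val := by
  classical
  have diag_mul {i k : n} (hik : i ≠ k) (p q r s : K) :
      φ i i (p * r) * φ k k (q * s) = φ i k (p * s) * φ k i (q * r) := by
    simpa [hik.symm] using
      hφ (fun a => if a = i then p else q) (fun a => if a = i then r else s) i i k k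
  have one_mul_one (i j k : n) : φ i k 1 * φ k j 1 = φ i j 1 := by
    simpa [hone] using (hφ 1 1 i j k k).symm
  have diag_eq (i k : n) (z : K) : φ i i z = φ k k z := by
    obtain rfl | hik := eq_or_ne i k
    · rfl
    · have hi := diag_mul hik 1 1 z 1
      have hk := diag_mul hik 1 z 1 1
      simp only [one_mul, mul_one, hone] at hi hk
      rw [hi, hk]
  have eq_diag_mul (i k : n) (z : K) : φ i k z = φ i i z * φ i k 1 := by
    obtain rfl | hik := eq_or_ne i k
    · rw [hone, mul_one]
    · have hz := diag_mul hik z 1 1 1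
      simp only [mul_one, hone] at hz
      rw [hz, mul_assoc, one_mul_one, hone, mul_one]
  obtain ⟨o, p, hop⟩ := exists_pair_ne n
  have map_mul (z w : K) : φ o o (z * w) = φ o o z * φ o o w := by
    have hzw := diag_mul hop z 1 w 1
    rw [mul_one, mul_one, one_mul, hone, mul_one, eq_diag_mul o p, eq_diag_mul p o,
      diag_eq p o] at hzw
    rw [hzw, mul_mul_mul_comm, one_mul_one, hone, mul_one]
  refine ⟨AlgHom.ofLinearMap (φ o o) (hone o) map_mul, fun i => ⟨φ i o 1, φ o i 1, ?_, ?_⟩,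
    fun i j z => ?_⟩
  · rw [one_mul_one, hone]
  · rw [one_mul_one, hone]
  · rw [Units.inv_mk, AlgHom.ofLinearMap_apply, eq_diag_mul i j, diag_eq i o, ← one_mul_one i j o]
    ring

variable {F n K : Type*} [CommRing F] [DecidableEq n] [Field K] [Algebra F K]
  {T : Matrix n n K →ₗ[F] Matrix n n K}

theorem map_single_one_ne_zero (hinj : Function.Injective T) (i j : n) : T (single i j 1) ≠ 0 :=
  (map_ne_zero_iff T hinj).2 fun h => by simpa using congrFun₂ h i j

variable [Fintype n]

theorem map_rowSubmodule_le_or (hrank : ∀ A, A.rank ≤ 1 → (T A).rank ≤ 1)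
    (hdiag : ∀ i, T (single i i 1) = single i i 1) (i : n) :
    (rowSubmodule F n K i).map T ≤ rowSubmodule F n K i ∨
      (rowSubmodule F n K i).map T ≤ colSubmodule F n K i := by
  refine le_rowSubmodule_or_le_colSubmodule ?_ ⟨_, single_mem_rowSubmodule i i 1, hdiag i⟩
  rintro _ ⟨A, hA, rfl⟩
  exact hrank A (rank_le_one_of_mem_rowSubmodule hA)

theorem map_colSubmodule_le_or (hrank : ∀ A, A.rank ≤ 1 → (T A).rank ≤ 1)
    (hdiag : ∀ i, T (single i i 1) = single i i 1) (j : n) :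
    (colSubmodule F n K j).map T ≤ rowSubmodule F n K j ∨
      (colSubmodule F n K j).map T ≤ colSubmodule F n K j := by
  refine le_rowSubmodule_or_le_colSubmodule ?_ ⟨_, single_mem_colSubmodule j j 1, hdiag j⟩
  rintro _ ⟨A, hA, rfl⟩
  exact hrank A (rank_le_one_of_mem_colSubmodule hA)

variable (hinj : Function.Injective T) (hrank : ∀ A, A.rank ≤ 1 → (T A).rank ≤ 1)
  (hdiag : ∀ i, T (single i i 1) = single i i 1)

include hinj hrank hdiag

theorem map_colSubmodule_le_of_ne {i j : n} (hij : i ≠ j)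
    (hrow : (rowSubmodule F n K i).map T ≤ rowSubmodule F n K i) :
    (colSubmodule F n K j).map T ≤ colSubmodule F n K j := by
  refine (map_colSubmodule_le_or hrank hdiag j).resolve_left fun hcol => ?_
  exact map_single_one_ne_zero hinj i j <| Submodule.disjoint_def.1 (disjoint_rowSubmodule hij) _
    (hrow ⟨_, single_mem_rowSubmodule i j 1, rfl⟩)
    (hcol ⟨_, single_mem_colSubmodule i j 1, rfl⟩)

theorem map_rowSubmodule_le_of_ne {j k : n} (hjk : j ≠ k)
    (hcol : (colSubmodule F n K j).map T ≤ colSubmodule F n K j) :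
    (rowSubmodule F n K k).map T ≤ rowSubmodule F n K k := by
  refine (map_rowSubmodule_le_or hrank hdiag k).resolve_right fun hrow => ?_
  exact map_single_one_ne_zero hinj k j <| Submodule.disjoint_def.1 (disjoint_colSubmodule hjk) _
    (hcol ⟨_, single_mem_colSubmodule k j 1, rfl⟩)
    (hrow ⟨_, single_mem_rowSubmodule k j 1, rfl⟩)

theorem map_colSubmodule_le [Nontrivial n] {i : n}
    (hrow : (rowSubmodule F n K i).map T ≤ rowSubmodule F n K i) (j : n) :
    (colSubmodule F n K j).map T ≤ colSubmodule F n K j := by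
  obtain rfl | hij := eq_or_ne j i
  swap
  · exact map_colSubmodule_le_of_ne hinj hrank hdiag hij.symm hrow
  -- Otherwise `T` moves both off-diagonal units on `{j, k}` to the position `(j, k)`, so the
  -- image of the all-ones block on `{j, k}` is triangular with unit diagonal, of rank two.
  refine (map_colSubmodule_le_or hrank hdiag j).resolve_left fun hcol => ?_
  obtain ⟨k, hkj⟩ := exists_ne j
  have hjk_row : T (single j k 1) ∈ rowSubmodule F n K j :=
    hrow ⟨_, single_mem_rowSubmodule j k 1, rfl⟩
  have hjk_col : T (single j k 1) ∈ colSubmodule F n K k :=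
    map_colSubmodule_le_of_ne hinj hrank hdiag hkj.symm hrow ⟨_, single_mem_colSubmodule j k 1, rfl⟩
  have hkj_row : T (single k j 1) ∈ rowSubmodule F n K j :=
    hcol ⟨_, single_mem_colSubmodule k j 1, rfl⟩
  have hkj_col : T (single k j 1) ∈ colSubmodule F n K k := by
    refine (map_rowSubmodule_le_or hrank hdiag k).resolve_left (fun h => ?_)
      ⟨_, single_mem_rowSubmodule k j 1, rfl⟩
    exact map_single_one_ne_zero hinj k j <|
      Submodule.disjoint_def.1 (disjoint_rowSubmodule hkj) _
        (h ⟨_, single_mem_rowSubmodule k j 1, rfl⟩) hkj_row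
  have hrank' : (T (single j j 1 + single j k 1 + single k j 1 + single k k 1)).rank ≤ 1 := by
    refine hrank _ (rank_le_one_iff_exists_vecMulVec.2
      ⟨Pi.single j 1 + Pi.single k 1, Pi.single j 1 + Pi.single k 1, ?_⟩)
    simp only [add_vecMulVec, vecMulVec_add, ← single_eq_single_vecMulVec_single]
    abel
  simpa [hdiag, hkj, hkj.symm, hjk_row k hkj, hkj_row k hkj, hjk_col j hkj.symm,
    hkj_col j hkj.symm] using mul_apply_comm_of_rank_le_one hrank' j k j k

theorem map_rowSubmodule_le [Nontrivial n] {i : n}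
    (hrow : (rowSubmodule F n K i).map T ≤ rowSubmodule F n K i) (k : n) :
    (rowSubmodule F n K k).map T ≤ rowSubmodule F n K k := by
  obtain ⟨j, hjk⟩ := exists_ne k
  exact map_rowSubmodule_le_of_ne hinj hrank hdiag hjk
    (map_colSubmodule_le hinj hrank hdiag hrow j)

theorem exists_algHom_of_map_rowSubmodule_le [Nontrivial n] {i : n}
    (hrow : (rowSubmodule F n K i).map T ≤ rowSubmodule F n K i) :
    ∃ (σ : K →ₐ[F] K) (U : GL n K), ∀ A, T A = U.val * A.map σ * U⁻¹.val := by
  let φ (i j : n) : K →ₗ[F] K := entryLinearMap F K i j ∘ₗ T ∘ₗ singleLinearMap F i j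
  have map_single (i j : n) (z : K) : T (single i j z) = single i j (φ i j z) :=
    eq_single_of_mem_rowSubmodule_of_mem_colSubmodule
      (map_rowSubmodule_le hinj hrank hdiag hrow i ⟨_, single_mem_rowSubmodule i j z, rfl⟩)
      (map_colSubmodule_le hinj hrank hdiag hrow j ⟨_, single_mem_colSubmodule i j z, rfl⟩)
  have map_apply (A : Matrix n n K) (i j : n) : T A i j = φ i j (A i j) := by
    conv_lhs => rw [matrix_eq_sum_single A]
    simp [map_single, Matrix.sum_apply, single_apply, ite_and]
  obtain ⟨σ, d, hσ⟩ := exists_algHom_of_map_mul_map_comm (φ := φ)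
    (fun i => by simp [φ, hdiag]) fun x y i j k l => by
      simpa only [map_apply, vecMulVec_apply] using
        mul_apply_comm_of_rank_le_one (hrank _ (rank_vecMulVec_le x y)) i k j l
  refine ⟨σ, Units.map (diagonalRingHom n K).toMonoidHom (MulEquiv.piUnits.symm d),
    fun A => ext fun i j => ?_⟩
  rw [map_apply, hσ]
  simp [diagonal_mul, mul_diagonal]

end NormalizedRankOnePreservers

section InvertibilityPreserversClassification

open Matrix

variable {F n K : Type*} [CommRing F] [Fintype n] [DecidableEq n] [Nontrivial n] [Field K]
  [Algebra F K]

theorem exists_algHom_of_map_single_self {T : Matrix n n K →ₗ[F] Matrix n n K}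
    (hinj : Function.Injective T) (hrank : ∀ A, A.rank ≤ 1 → (T A).rank ≤ 1)
    (hdiag : ∀ i, T (single i i 1) = single i i 1) :
    ∃ (σ : K →ₐ[F] K) (U : GL n K), (∀ A, T A = U.val * A.map σ * U⁻¹.val) ∨
      ∀ A, T A = U.val * (A.map σ)ᵀ * U⁻¹.val := by
  obtain ⟨i⟩ : Nonempty n := inferInstance
  obtain hrow | hcol := map_rowSubmodule_le_or hrank hdiag i
  · obtain ⟨σ, U, hT⟩ := exists_algHom_of_map_rowSubmodule_le hinj hrank hdiag hrow
    exact ⟨σ, U, .inl hT⟩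
  · let T' : Matrix n n K →ₗ[F] Matrix n n K := (transposeLinearEquiv n n F K).toLinearMap ∘ₗ T
    have hrow' : (rowSubmodule F n K i).map T' ≤ rowSubmodule F n K i := by
      rintro _ ⟨A, hA, rfl⟩ k hk l
      exact hcol ⟨A, hA, rfl⟩ k hk l
    obtain ⟨σ, U, hT'⟩ := exists_algHom_of_map_rowSubmodule_le (T := T')
      (transpose_injective.comp hinj) (fun A hA => (rank_transpose _).trans_le (hrank A hA))
      (fun j => by simp [T', hdiag]) hrow'
    let V : GL n K := ⟨U⁻¹.valᵀ, U.valᵀ, by rw [← transpose_mul]; simp, by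
      rw [← transpose_mul]; simp⟩
    refine ⟨σ, V, .inr fun A => ?_⟩
    calc T A = (U.val * A.map σ * U⁻¹.val)ᵀ := by rw [← hT']; rfl
      _ = V.val * (A.map σ)ᵀ * V⁻¹.val := by simp only [transpose_mul, Matrix.mul_assoc]; rfl

theorem exists_algHom_of_map_one {T : Matrix n n K →ₗ[F] Matrix n n K}
    (hinj : Function.Injective T) (hrank : ∀ A, A.rank ≤ 1 → (T A).rank ≤ 1) (hone : T 1 = 1) :
    ∃ (σ : K →ₐ[F] K) (U : GL n K), (∀ A, T A = U.val * A.map σ * U⁻¹.val) ∨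
      ∀ A, T A = U.val * (A.map σ)ᵀ * U⁻¹.val := by
  obtain ⟨V, hV⟩ := exists_GL_eq_conj_single (P := fun i => T (single i i 1))
    (fun i => hrank _ (rank_le_one_of_mem_rowSubmodule (single_mem_rowSubmodule (F := F) i i 1)))
    (by rw [← map_sum, sum_single_one, hone])
  let conj : Matrix n n K →ₗ[F] Matrix n n K := LinearMap.mulLeftRight F (V⁻¹.val, V.val)
  have conj_apply (A : Matrix n n K) : conj A = V⁻¹.val * A * V.val :=
    LinearMap.mulLeftRight_apply ..
  have eq_conj (A B : Matrix n n K) (h : conj A = B) : A = V.val * B * V⁻¹.val := by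
    rw [← h, conj_apply]
    simp only [Matrix.mul_assoc, Units.mul_inv_cancel_left, Units.mul_inv, Matrix.mul_one]
  have conj_injective : Function.Injective conj := fun A B h =>
    (eq_conj A _ h).trans (eq_conj B _ rfl).symm
  have rank_conj_le (A : Matrix n n K) : (conj A).rank ≤ A.rank := by
    rw [conj_apply]
    exact (rank_mul_le_left _ _).trans (rank_mul_le_right _ _)
  obtain ⟨σ, U, hU⟩ := exists_algHom_of_map_single_self (T := conj ∘ₗ T)
    (conj_injective.comp hinj) (fun A hA => (rank_conj_le _).trans (hrank A hA))
    (fun i => by simp only [LinearMap.comp_apply, conj_apply, hV, Matrix.mul_assoc,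
        Units.inv_mul_cancel_left, Units.inv_mul, Matrix.mul_one])
  refine ⟨σ, V * U, hU.imp (fun h A => ?_) fun h A => ?_⟩
  all_goals
    rw [eq_conj _ _ (h A), _root_.mul_inv_rev, Units.val_mul, Units.val_mul]
    simp only [Matrix.mul_assoc]

theorem exists_algHom_of_isUnit_map_iff [NeZero (2 : K)] {T : Matrix n n K ≃ₗ[F] Matrix n n K}
    (hT : ∀ A, IsUnit (T A) ↔ IsUnit A) :
    ∃ (σ : K →ₐ[F] K) (U : GL n K), (∀ A, T A = T 1 * U.val * A.map σ * U⁻¹.val) ∨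
      ∀ A, T A = T 1 * U.val * (A.map σ)ᵀ * U⁻¹.val := by
  obtain ⟨g, hg⟩ := (hT 1).2 isUnit_one
  have eq_mul (A B : Matrix n n K) (h : g⁻¹.val * A = B) : A = T 1 * B := by
    rw [← h, ← hg, Units.mul_inv_cancel_left]
  obtain ⟨σ, U, hU⟩ := exists_algHom_of_map_one (T := LinearMap.mulLeft F g⁻¹.val ∘ₗ T.toLinearMap)
    (fun A B h => T.injective (g⁻¹.mul_right_inj.1 h))
    (fun A hA => (rank_mul_le_right _ _).trans
      (rank_map_le_one_of_isUnit_map_iff (T := T.toAddEquiv) hT hA))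
    (by simp [← hg])
  refine ⟨σ, U, hU.imp (fun h A => ?_) fun h A => ?_⟩
  all_goals
    rw [eq_mul (T A) _ (h A)]
    simp only [Matrix.mul_assoc]

end InvertibilityPreserversClassification

section OneDimensional

open Matrix

theorem exists_algHom_of_norm_map_eq_mul {f : ℂ →ₗ[ℝ] ℂ} (hf : ∀ z, ‖f z‖ = ‖f 1‖ * ‖z‖) :
    ∃ σ : ℂ →ₐ[ℝ] ℂ, ∀ z, f z = f 1 * σ z := by
  obtain hzero | hne := eq_or_ne (f 1) 0
  · exact ⟨.id ℝ ℂ, fun z => by simpa [hzero] using hf z⟩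
  let g : ℂ →ₗᵢ[ℝ] ℂ :=
    ⟨LinearMap.mulLeft ℝ (f 1)⁻¹ ∘ₗ f, fun z => by simp [hf z, hne]⟩
  have hg (z : ℂ) : f z = f 1 * g.toLinearIsometryEquiv rfl z := (mul_inv_cancel_left₀ hne _).symm
  obtain hid | hconj := linear_isometry_complex_aux (f := g.toLinearIsometryEquiv rfl)
    (inv_mul_cancel₀ hne)
  · exact ⟨.id ℝ ℂ, fun z => by rw [hg, hid]; rfl⟩
  · exact ⟨Complex.conjAe, fun z => by rw [hg, hconj]; rfl⟩

theorem exists_algHom_of_subsingleton {n : Type*} [Fintype n] [DecidableEq n] [Subsingleton n]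
    {p q : Seminorm ℂ (Matrix n n ℂ)} (hq : ∀ A, q A = 0 → A = 0)
    {T : Matrix n n ℂ →ₗ[ℝ] Matrix n n ℂ} (hT : ∀ A, q (T A) = p A) :
    ∃ σ : ℂ →ₐ[ℝ] ℂ, ∀ A, T A = T 1 * A.map σ := by
  obtain hempty | ⟨⟨i⟩⟩ := isEmpty_or_nonempty n
  · exact ⟨.id ℝ ℂ, fun A => Subsingleton.elim _ _⟩
  have : Unique n := uniqueOfSubsingleton i
  have eq_smul_one (A : Matrix n n ℂ) : A = A i i • (1 : Matrix n n ℂ) := by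
    ext k l
    simp [Subsingleton.elim k i, Subsingleton.elim l i]
  have apply_eq (r : Seminorm ℂ (Matrix n n ℂ)) (A : Matrix n n ℂ) : r A = ‖A i i‖ * r 1 := by
    conv_lhs => rw [eq_smul_one A, map_smul_eq_mul]
  let f : ℂ →ₗ[ℝ] ℂ := entryLinearMap ℝ ℂ i i ∘ₗ T ∘ₗ
    (LinearMap.toSpanSingleton ℂ (Matrix n n ℂ) 1).restrictScalars ℝ
  have hf_apply (z : ℂ) : f z = T (z • 1) i i := rfl
  have hf_mul (z : ℂ) : ‖f z‖ * q 1 = ‖z‖ * p 1 := by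
    rw [hf_apply, ← apply_eq, hT, map_smul_eq_mul]
  have hf (z : ℂ) : ‖f z‖ = ‖f 1‖ * ‖z‖ := by
    refine mul_right_cancel₀ (fun h => one_ne_zero (hq 1 h)) ?_
    rw [hf_mul, mul_right_comm, hf_mul, norm_one, one_mul, mul_comm]
  obtain ⟨σ, hσ⟩ := exists_algHom_of_norm_map_eq_mul hf
  refine ⟨σ, fun A => ?_⟩
  rw [eq_smul_one (T A), eq_smul_one (T 1 * A.map σ)]
  congr 1
  simpa [hf_apply, ← eq_smul_one, mul_apply, Subsingleton.elim default i] using hσ (A i i)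

end OneDimensional

section Isometries

open Matrix

variable {n : Type*} [Fintype n] [DecidableEq n]

variable {p q : Seminorm ℂ (Matrix n n ℂ)} {𝔄 𝔅 : OpenSubgroup (GL n ℂ)} {S : 𝔄 → 𝔅}
  (hp : ∀ A, p A = 0 → A = 0) (hq : ∀ A, q A = 0 → A = 0) (hS : Function.Surjective S)
  (hpq : ∀ M N : 𝔄, q ((S M : GL n ℂ).val - (S N : GL n ℂ).val) =
    p ((M : GL n ℂ).val - (N : GL n ℂ).val))

include hp hq hS hpq

theorem exists_linearEquiv_of_isometry :
    ∃ T : Matrix n n ℂ ≃ₗ[ℝ] Matrix n n ℂ, (∀ A, q (T A) = p A) ∧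
      (∀ A, IsUnit (T A) ↔ IsUnit A) ∧ ∀ M : 𝔄, T (M : GL n ℂ).val = (S M : GL n ℂ).val := by
  have surjective : Function.Surjective fun M => (S M : GL n ℂ) := fun g =>
    (hS ⟨g, mem_openSubgroup_GL 𝔅 g⟩).imp fun _ => congrArg Subtype.val
  obtain ⟨T, c, hT, hTc⟩ := exists_linearEquiv_add_of_seminorm (p := p.restrictScalars ℝ)
    (q := q.restrictScalars ℝ) (a := fun M : 𝔄 => (M : GL n ℂ).val)
    (b := fun M => (S M : GL n ℂ).val) hp hq
    (fun A ε hε => (exists_GL_seminorm_sub_lt p A hε).elim fun g hg =>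
      ⟨⟨g, mem_openSubgroup_GL 𝔄 g⟩, hg⟩)
    (fun A ε hε => surjective.exists.1 (exists_GL_seminorm_sub_lt q A hε)) hpq
  have isUnit_iff (A : Matrix n n ℂ) : IsUnit (T A + c) ↔ IsUnit A := by
    constructor
    · rintro ⟨h, hh⟩
      obtain ⟨M, rfl⟩ := surjective h
      exact ⟨M, T.injective (add_right_cancel ((hTc M).trans hh))⟩
    · rintro ⟨g, rfl⟩
      exact ⟨S ⟨g, mem_openSubgroup_GL 𝔄 g⟩, (hTc _).symm⟩
  obtain rfl : c = 0 := eq_zero_of_isUnit_map_add_iff (T := T.toAddEquiv) isUnit_iff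
  exact ⟨T, hT, by simpa using isUnit_iff, by simpa using hTc⟩

theorem exists_algHom_of_isometry :
    ∃ (σ : ℂ →ₐ[ℝ] ℂ) (U : GL n ℂ),
      (∀ M : 𝔄, (S M : GL n ℂ).val =
        (S 1 : GL n ℂ).val * U.val * (M : GL n ℂ).val.map σ * U⁻¹.val) ∨
      ∀ M : 𝔄, (S M : GL n ℂ).val =
        (S 1 : GL n ℂ).val * U.val * ((M : GL n ℂ).val.map σ)ᵀ * U⁻¹.val := by
  obtain ⟨T, hT, hunit, hTS⟩ := exists_linearEquiv_of_isometry hp hq hS hpq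
  simp only [← hTS]
  obtain hn | hn := subsingleton_or_nontrivial n
  · obtain ⟨σ, hσ⟩ := exists_algHom_of_subsingleton (T := T.toLinearMap) hq hT
    exact ⟨σ, 1, .inl fun M => by simpa using hσ (M : GL n ℂ).val⟩
  · obtain ⟨σ, U, h⟩ := exists_algHom_of_isUnit_map_iff hunit
    exact ⟨σ, U, h.imp (fun h M => h _) fun h M => h _⟩

end Isometries

theorem corollary5p5_general {n : Type*} [Fintype n] [DecidableEq n]
    (ν ν' : Seminorm ℂ (Matrix n n ℂ)) (hν : ∀ A, ν A = 0 → A = 0) (hν' : ∀ A, ν' A = 0 → A = 0)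
    (𝔄 𝔅 : OpenSubgroup (GL n ℂ)) (S : 𝔄 → 𝔅) (hsurj : Function.Surjective S)
    (hiso : ∀ M N : 𝔄, ν' ((S M : GL n ℂ).val - (S N : GL n ℂ).val) =
      ν ((M : GL n ℂ).val - (N : GL n ℂ).val)) :
    (∃ U : GL n ℂ,
      (∀ M : 𝔄, (S M : GL n ℂ).val =
        (S 1 : GL n ℂ).val * U.val * (M : GL n ℂ).val * U⁻¹.val) ∨
      (∀ M : 𝔄, (S M : GL n ℂ).val =
        (S 1 : GL n ℂ).val * U.val * (M : GL n ℂ).valᵀ * U⁻¹.val) ∨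
      (∀ M : 𝔄, (S M : GL n ℂ).val =
        (S 1 : GL n ℂ).val * U.val * (M : GL n ℂ).val.map (starRingEnd ℂ) * U⁻¹.val) ∨
      (∀ M : 𝔄, (S M : GL n ℂ).val =
        (S 1 : GL n ℂ).val * U.val * ((M : GL n ℂ).val.map (starRingEnd ℂ))ᵀ * U⁻¹.val)) ∧
    (S 1 = 1 →
      (∀ M N : 𝔄, S (M * N) = S M * S N) ∨ (∀ M N : 𝔄, S (M * N) = S N * S M)) := by
  obtain ⟨σ, U, hU⟩ := exists_algHom_of_isometry hν hν' hsurj hiso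
  refine ⟨⟨U, ?_⟩, fun hone => ?_⟩
  · obtain rfl | rfl := Complex.real_algHom_eq_id_or_conj σ
    · exact hU.elim .inl fun h => .inr (.inl h)
    · exact .inr (.inr hU)
  · simp only [hone, OneMemClass.coe_one, Units.val_one, one_mul] at hU
    refine hU.imp (fun h M N => Subtype.ext (Units.ext ?_)) fun h M N => Subtype.ext (Units.ext ?_)
    · simp only [h, MulMemClass.coe_mul, Units.val_mul, Matrix.map_mul, mul_assoc,
        Units.inv_mul_cancel_left]
    · simp only [h, MulMemClass.coe_mul, Units.val_mul, Matrix.map_mul, Matrix.transpose_mul,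
        mul_assoc, Units.inv_mul_cancel_left]

theorem corollary5p5 (n : ℕ)
    (ν ν' : AlgebraNorm ℂ (Matrix (Fin n) (Fin n) ℂ))
    (𝔄 𝔅 : OpenSubgroup (GL (Fin n) ℂ))
    (S : 𝔄 → 𝔅) (hsurj : Function.Surjective S)
    (hiso : ∀ M N : 𝔄,
      ν' (((S M : GL (Fin n) ℂ) : Matrix (Fin n) (Fin n) ℂ) - (S N : GL (Fin n) ℂ)) =
        ν (((M : GL (Fin n) ℂ) : Matrix (Fin n) (Fin n) ℂ) - (N : GL (Fin n) ℂ))) :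
    (∃ U : GL (Fin n) ℂ,
      (∀ M : 𝔄, ((S M : GL (Fin n) ℂ) : Matrix (Fin n) (Fin n) ℂ) =
        (S 1 : GL (Fin n) ℂ).val * U.val * (M : GL (Fin n) ℂ).val * U⁻¹.val) ∨
      (∀ M : 𝔄, ((S M : GL (Fin n) ℂ) : Matrix (Fin n) (Fin n) ℂ) =
        (S 1 : GL (Fin n) ℂ).val * U.val * (M : GL (Fin n) ℂ).valᵀ * U⁻¹.val) ∨
      (∀ M : 𝔄, ((S M : GL (Fin n) ℂ) : Matrix (Fin n) (Fin n) ℂ) =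
        (S 1 : GL (Fin n) ℂ).val * U.val *
          (M : GL (Fin n) ℂ).val.map (starRingEnd ℂ) * U⁻¹.val) ∨
      (∀ M : 𝔄, ((S M : GL (Fin n) ℂ) : Matrix (Fin n) (Fin n) ℂ) =
        (S 1 : GL (Fin n) ℂ).val * U.val *
          ((M : GL (Fin n) ℂ).val.map (starRingEnd ℂ))ᵀ * U⁻¹.val)) ∧
    (S 1 = 1 →
      (∀ M N : 𝔄, S (M * N) = S M * S N) ∨ (∀ M N : 𝔄, S (M * N) = S N * S M)) :=
  corollary5p5_general ν.toSeminorm ν'.toSeminorm (fun _ => eq_zero_of_map_eq_zero ν)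
    (fun _ => eq_zero_of_map_eq_zero ν') 𝔄 𝔅 S hsurj hiso
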